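/- For a finite graph $G$, the Mostar index is $Mo(G)=\sum_{uv\in E(G)}|n_u-n_v|$, where $n_u$ is the number of vertices of $G$ closer to $u$ than to $v$ and $n_v$ the number of vertices closer to $v$ than to $u$. Let $n\ge 1$ be an integer, and let $\mathcal{O}_{2n}$ be the set of all trees on $2n$ vertices in which every vertex has odd degree. Let $S_{2n}$ be the star on $2n$ vertices, and let $C_{2n,0,n-1}$ be the caterpillar obtained from the path $v_1v_2\cdots v_{n+1}$ by attaching one pendent vertex to $v_i$ for each $2\le i\le n$. Then $S_{2n}$ and $C_{2n,0,n-1}$ belong to $\mathcal{O}_{2n}$, and every $T\in\mathcal{O}_{2n}$ satisfies $$Mo(C_{2n,0,n-1})\le Mo(T)\le Mo(S_{2n}),$$ where the upper bound is attained if and only if $T\cong S_{2n}$, and the lower bound is attained if and only if $T\cong C_{2n,0,n-1}$. -/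

import Mathlib

/-- `closerCount G u v` is the number of vertices of `G` that are closer to `u` than to `v`. -/
noncomputable def closerCount {V : Type*} (G : SimpleGraph V) (u v : V) : ℕ :=
  {w : V | G.dist w u < G.dist w v}.ncard

/-- The contribution `ψ(e) = |n_u - n_v|` of an unordered pair `e = uv`. -/
noncomputable def edgeImbalance {V : Type*} (G : SimpleGraph V) : Sym2 V → ℤ :=
  Sym2.lift ⟨fun u v => |(closerCount G u v : ℤ) - (closerCount G v u : ℤ)|,
    fun _ _ => abs_sub_comm _ _⟩

open Classical in
/-- The Mostar index of a finite graph: the sum of `ψ(e)` over its edges `e`. -/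
noncomputable def mostarIndex {V : Type*} [Fintype V] (G : SimpleGraph V) : ℤ :=
  ∑ e ∈ G.edgeFinset, edgeImbalance G e

open Classical in
/-- `IsOddTree m T`: `T` is a tree on `m` vertices, all of which have odd degree. -/
def IsOddTree {V : Type*} [Fintype V] (m : ℕ) (T : SimpleGraph V) : Prop :=
  T.IsTree ∧ Fintype.card V = m ∧ ∀ v : V, Odd (T.degree v)

/-- The star on `m ≥ 1` vertices. -/
def starTree (m : ℕ) (hm : 0 < m) : SimpleGraph (Fin m) :=
  SimpleGraph.starGraph ⟨0, hm⟩

/-- The vertices of the caterpillar `C_{m,a,b}`: the `m - a - b` vertices of the path (`.inl j` is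
the path vertex `v_{j+1}`), then the two groups of `a` and of `b` attached pendent vertices. -/
abbrev CaterpillarVertex (m a b : ℕ) : Type :=
  Fin (m - a - b) ⊕ (Fin a ⊕ Fin b)

/-- Adjacency of `C_{m,a,b}`, each edge in one orientation: `v_k` is joined to `v_{k+1}`, the `i`-th
vertex of the first group (`0 ≤ i < a`) to `v_{i+2}`, and the `i`-th vertex of the second group
(`0 ≤ i < b`) to `v_{m-a-2b+i}`. -/
def caterpillarRel (m a b : ℕ) : CaterpillarVertex m a b → CaterpillarVertex m a b → Prop
  | .inl j, .inl k => (j : ℕ) + 1 = (k : ℕ)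
  | .inl j, .inr (.inl i) => (j : ℕ) + 1 = (i : ℕ) + 2
  | .inl j, .inr (.inr i) => ((j : ℕ) + 1) + a + 2 * b = m + (i : ℕ)
  | _, _ => False

/-- The caterpillar `C_{m,a,b}` (for `2 * (a + b) ≤ m - 1`): the path `v_1 v_2 … v_{m-a-b}` with one
pendent vertex attached to `v_i` for each `2 ≤ i ≤ a + 1` and one for each
`m - a - 2b ≤ i ≤ m - a - b - 1`. -/
def caterpillar (m a b : ℕ) : SimpleGraph (CaterpillarVertex m a b) :=
  SimpleGraph.fromRel (caterpillarRel m a b)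

open SimpleGraph Finset

/-! ### Edge imbalance through edge cuts. -/

section Cuts

variable {V : Type*} {G : SimpleGraph V}

/-! Write `N` for the number of vertices. For the upper bound, an edge has imbalance at most `N -
2`, with equality only if one end is a leaf. A tree has `N - 1` edges, and if each of them has a
leaf end the tree is a star.

For the lower bound, an edge `e` of a tree has `N - ψ(e)` equal to twice its smaller side, hence at
most twice the number of vertices that `e` separates from a root `a`. Double counting gives `N(N -
1) - Mo(T) ≤ 2 ∑ dist(w, a)` (`le_mostarIndex_add_sum_dist`). Take for `a` each of the two middle
vertices of a diametral path of length `d` and average. Every vertex has total distance at most `d`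
to these two (`dist_add_dist_le`), and vertices near the middle have less. Odd degrees give each
inner path vertex a further neighbour, so the saving is made on `d + 1` path vertices and `d - 1`
pendent ones. This also gives `2d ≤ N = 2n`. The resulting bound decreases strictly in `d`, up to a
harmless parity term, so its minimum is at `d = n`. Then path and pendent vertices exhaust the tree,
which is the caterpillar. A direct estimate shows that the caterpillar does not exceed this minimum.
-/

theorem dist_add_one_le_length_of_cut {S : Set V} {u v : V}
    (hcut : ∀ x y, G.Adj x y → x ∈ S → y ∉ S → x = u ∧ y = v) (hG : G.Connected) (hv : v ∉ S) :
    ∀ {w : V} (p : G.Walk w v), w ∈ S → G.dist w u + 1 ≤ p.length := by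
  intro w p hw
  induction p with
  | nil => exact absurd hw hv
  | @cons a b _ hab p ih =>
    by_cases hb : b ∈ S
    · have h1 := ih hcut hv hb
      have h2 := hG.dist_triangle (u := a) (v := b) (w := u)
      have h3 : G.dist a b = 1 := dist_eq_one_iff_adj.mpr hab
      simp only [Walk.length_cons]
      omega
    · obtain ⟨rfl, -⟩ := hcut a b hab hw hb
      simp

/-- A geodesic from `w` to `v` has to leave `S`, which is possible only along `uv`, so it meets `u`
before `v`. -/
theorem dist_lt_of_cut {S : Set V} {u v : V}
    (hcut : ∀ x y, G.Adj x y → x ∈ S → y ∉ S → x = u ∧ y = v) (hG : G.Connected) (hv : v ∉ S)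
    {w : V} (hw : w ∈ S) : G.dist w u < G.dist w v := by
  obtain ⟨p, hp⟩ := hG.exists_walk_length_eq_dist w v
  have := dist_add_one_le_length_of_cut hcut hG hv p hw
  omega

/-- If `uv` is the only edge leaving `S`, the vertices closer to `u` than to `v` are those of `S`. -/
theorem setOf_dist_lt_eq_of_cut {S : Set V} {u v : V}
    (hcut : ∀ x y, G.Adj x y → x ∈ S → y ∉ S → x = u ∧ y = v) (hG : G.Connected)
    (hu : u ∈ S) (hv : v ∉ S) :
    {w | G.dist w u < G.dist w v} = S ∧ {w | G.dist w v < G.dist w u} = Sᶜ := by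
  have h1 : ∀ w ∈ S, G.dist w u < G.dist w v := fun w hw => dist_lt_of_cut hcut hG hv hw
  have h2 : ∀ w ∈ Sᶜ, G.dist w v < G.dist w u := fun w hw =>
    dist_lt_of_cut (S := Sᶜ) (fun x y hxy hx hy =>
      (hcut y x hxy.symm (by simpa using hy) hx).symm) hG (by simpa using hu) hw
  constructor
  · ext w
    refine ⟨fun hw => ?_, h1 w⟩
    by_contra hS
    exact lt_asymm hw (h2 w hS)
  · ext w
    exact ⟨fun hw hS => lt_asymm hw (h1 w hS), h2 w⟩

theorem closerCount_eq_of_cut {S : Set V} {u v : V}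
    (hcut : ∀ x y, G.Adj x y → x ∈ S → y ∉ S → x = u ∧ y = v) (hG : G.Connected)
    (hu : u ∈ S) (hv : v ∉ S) :
    closerCount G u v = S.ncard ∧ closerCount G v u = Sᶜ.ncard := by
  obtain ⟨h1, h2⟩ := setOf_dist_lt_eq_of_cut hcut hG hu hv
  exact ⟨congrArg Set.ncard h1, congrArg Set.ncard h2⟩

theorem edgeImbalance_mk (u v : V) : edgeImbalance G s(u, v) =
    |(closerCount G u v : ℤ) - (closerCount G v u : ℤ)| := rfl

theorem edgeImbalance_nonneg (e : Sym2 V) : 0 ≤ edgeImbalance G e := by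
  induction e with
  | h u v => exact abs_nonneg _

theorem edgeImbalance_eq_of_cut [Fintype V] {S : Set V} {u v : V}
    (hcut : ∀ x y, G.Adj x y → x ∈ S → y ∉ S → x = u ∧ y = v) (hG : G.Connected)
    (hu : u ∈ S) (hv : v ∉ S) :
    edgeImbalance G s(u, v) = |2 * (S.ncard : ℤ) - Fintype.card V| := by
  obtain ⟨h1, h2⟩ := closerCount_eq_of_cut hcut hG hu hv
  have h3 := S.ncard_add_ncard_compl
  rw [Nat.card_eq_fintype_card] at h3
  rw [edgeImbalance_mk, h1, h2, ← h3]
  congr 1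
  push_cast
  ring

/-- The two counted sets are disjoint and each contains its own end of the edge, so both counts are
positive and their sum is at most the order. -/
theorem edgeImbalance_le [Fintype V] {u v : V} (h : G.Adj u v) :
    edgeImbalance G s(u, v) ≤ (Fintype.card V : ℤ) - 2 ∧
    (edgeImbalance G s(u, v) = (Fintype.card V : ℤ) - 2 →
      closerCount G u v = 1 ∨ closerCount G v u = 1) := by
  have h1 : G.dist u v = 1 := dist_eq_one_iff_adj.mpr h
  have h1' : G.dist v u = 1 := dist_eq_one_iff_adj.mpr h.symm
  have hu : 0 < closerCount G u v := (Set.ncard_pos).mpr ⟨u, by simp [h1]⟩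
  have hv : 0 < closerCount G v u := (Set.ncard_pos).mpr ⟨v, by simp [h1']⟩
  have hsum : closerCount G u v + closerCount G v u ≤ Fintype.card V := by
    rw [closerCount, closerCount, ← Set.ncard_union_eq, ← Nat.card_eq_fintype_card]
    · exact Set.ncard_le_card _
    · refine Set.disjoint_left.mpr fun w hw hw' => ?_
      rw [Set.mem_ofPred_eq] at hw hw'
      omega
  rw [edgeImbalance_mk]
  rcases abs_cases ((closerCount G u v : ℤ) - (closerCount G v u : ℤ)) with ⟨h, -⟩ | ⟨h, -⟩ <;>
    rw [h] <;> omega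

end Cuts

/-! ### Imbalances and distances to a root in a tree. -/

section Trees

variable {V : Type*} {T : SimpleGraph V}

theorem SimpleGraph.IsTree.cut_of_adj (hT : T.IsTree) {u v : V} (h : T.Adj u v) :
    (∀ x y, T.Adj x y → x ∈ {w | (T.deleteEdges {s(u, v)}).Reachable w u} →
      y ∉ {w | (T.deleteEdges {s(u, v)}).Reachable w u} → x = u ∧ y = v) ∧
    v ∉ {w | (T.deleteEdges {s(u, v)}).Reachable w u} := by
  have hb := isBridge_iff.mp (isAcyclic_iff_forall_adj_isBridge.mp hT.isAcyclic h)
  have hv : v ∉ {w | (T.deleteEdges {s(u, v)}).Reachable w u} := fun hr => hb hr.symm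
  refine ⟨fun x y hxy hx hy => ?_, hv⟩
  by_cases he : s(x, y) = s(u, v)
  · rcases Sym2.eq_iff.mp he with h' | ⟨rfl, rfl⟩
    · exact h'
    · exact absurd hx hv
  · refine absurd ?_ hy
    have : (T.deleteEdges {s(u, v)}).Adj y x := by
      rw [deleteEdges_adj]
      exact ⟨hxy.symm, by rwa [Set.mem_singleton_iff, Sym2.eq_swap]⟩
    exact this.reachable.trans hx

/-- In a tree, a vertex has at most one neighbour closer to a given root. -/
theorem SimpleGraph.IsTree.eq_of_adj_of_dist_lt (hT : T.IsTree) {c x y z : V}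
    (hy : T.Adj x y) (hz : T.Adj x z) (hyc : T.dist c y < T.dist c x)
    (hzc : T.dist c z < T.dist c x) : y = z := by
  -- A geodesic to `t` extended by the edge to `x` is a path, and the path from `c` to `x` is
  -- unique.
  have key : ∀ t, T.Adj x t → T.dist c t < T.dist c x →
      ∃ p : T.Walk c x, p.IsPath ∧ p.penultimate = t := by
    intro t ht htc
    obtain ⟨p, hp⟩ := hT.connected.exists_walk_length_eq_dist c t
    refine ⟨p.concat ht.symm, Walk.isPath_of_length_eq_dist _ ?_, by simp⟩
    have := hT.dist_eq_dist_add_one_of_adj c ht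
    rw [Walk.length_concat]
    omega
  obtain ⟨p, hp, rfl⟩ := key y hy hyc
  obtain ⟨q, hq, rfl⟩ := key z hz hzc
  have := (hT.isAcyclic.subsingleton_path c x).elim ⟨p, hp⟩ ⟨q, hq⟩
  rw [Subtype.mk.inj this]

/-- Deleting an edge of a tree separates any root from at least half of the vertices that the
imbalance leaves uncounted. -/
theorem SimpleGraph.IsTree.card_le_edgeImbalance_add [Fintype V] (hT : T.IsTree) (a : V)
    {e : Sym2 V} (he : e ∈ T.edgeSet) : (Fintype.card V : ℤ) ≤ edgeImbalance T e +
      2 * ({w | ¬ (T.deleteEdges {e}).Reachable w a}.ncard : ℤ) := by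
  induction e with
  | h u v =>
    rw [mem_edgeSet] at he
    obtain ⟨hcut, hv⟩ := hT.cut_of_adj he
    set S := {w | (T.deleteEdges {s(u, v)}).Reachable w u} with hS
    have hu : u ∈ S := Reachable.refl u
    rw [edgeImbalance_eq_of_cut hcut hT.connected hu hv]
    have h3 := S.ncard_add_ncard_compl
    rw [Nat.card_eq_fintype_card] at h3
    by_cases ha : a ∈ S
    · have : Sᶜ.ncard ≤ {w | ¬ (T.deleteEdges {s(u, v)}).Reachable w a}.ncard :=
        Set.ncard_le_ncard fun w hw hr => hw (hr.trans ha)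
      have := le_abs_self (2 * (S.ncard : ℤ) - Fintype.card V)
      omega
    · have : S.ncard ≤ {w | ¬ (T.deleteEdges {s(u, v)}).Reachable w a}.ncard :=
        Set.ncard_le_ncard fun w hw hr => ha (hr.symm.trans hw)
      have := neg_le_abs (2 * (S.ncard : ℤ) - Fintype.card V)
      omega

-- Any edge missing from a geodesic between `w` and `a` can be deleted without separating them.
open Classical in
theorem SimpleGraph.Connected.card_separating_edges_le_dist [Fintype V] (hT : T.Connected)
    (w a : V) :
    #{e ∈ T.edgeFinset | ¬ (T.deleteEdges {e}).Reachable w a} ≤ T.dist w a := by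
  obtain ⟨p, hp⟩ := hT.exists_walk_length_eq_dist w a
  calc _ ≤ #p.edges.toFinset := by
        refine card_le_card fun e he => ?_
        rw [mem_filter] at he
        by_contra hne
        rw [List.mem_toFinset] at hne
        refine he.2 ⟨p.toDeleteEdges {e} fun e' he' h => ?_⟩
        rw [Set.mem_singleton_iff] at h
        exact hne (h ▸ he')
    _ ≤ p.edges.length := List.toFinset_card_le _
    _ = T.dist w a := by rw [Walk.length_edges, hp]

/-- Double counting of the pairs of an edge and a vertex that it separates from `a`. -/
theorem SimpleGraph.IsTree.le_mostarIndex_add_sum_dist [Fintype V] (hT : T.IsTree) (a : V) :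
    (Fintype.card V : ℤ) * (Fintype.card V - 1) ≤
      mostarIndex T + 2 * ∑ w, (T.dist w a : ℤ) := by
  classical
  have hcard := hT.card_edgeFinset
  have h1 : ∑ e ∈ T.edgeFinset, (Fintype.card V : ℤ) ≤ ∑ e ∈ T.edgeFinset, (edgeImbalance T e +
      2 * (#{w | ¬ (T.deleteEdges {e}).Reachable w a} : ℤ)) := by
    refine sum_le_sum fun e he => ?_
    have := hT.card_le_edgeImbalance_add a (mem_edgeFinset.mp he)
    rwa [Set.ncard_eq_toFinset_card', Set.toFinset_ofPred] at this
  have h2 : ∑ e ∈ T.edgeFinset, #{w | ¬ (T.deleteEdges {e}).Reachable w a} ≤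
      ∑ w, T.dist w a := by
    have := sum_card_bipartiteAbove_eq_sum_card_bipartiteBelow (s := T.edgeFinset) (t := univ)
      (fun e w => ¬ (T.deleteEdges {e}).Reachable w a)
    simp only [bipartiteAbove, bipartiteBelow] at this
    rw [this]
    exact sum_le_sum fun w _ => hT.connected.card_separating_edges_le_dist w a
  rw [sum_const, nsmul_eq_mul, sum_add_distrib, ← mul_sum] at h1
  have h3 : ((T.edgeFinset.card : ℕ) : ℤ) = Fintype.card V - 1 := by omega
  zify at h2
  rw [h3] at h1
  rw [mostarIndex]
  linarith [mul_comm (Fintype.card V : ℤ) (Fintype.card V - 1)]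

end Trees

theorem mostarIndex_eq_sum {V : Type*} [Fintype V] (G : SimpleGraph V) [Fintype G.edgeSet] :
    mostarIndex G = ∑ e ∈ G.edgeFinset, edgeImbalance G e := by
  rw [mostarIndex]
  congr!

/-! ### Invariance under isomorphism. -/

section Iso

variable {V W : Type*} {G : SimpleGraph V} {H : SimpleGraph W}

theorem SimpleGraph.Connected.dist_map_le (hG : G.Connected) (f : G →g H) (u v : V) :
    H.dist (f u) (f v) ≤ G.dist u v := by
  obtain ⟨p, hp⟩ := hG.exists_walk_length_eq_dist u v
  rw [← hp, ← Walk.length_map f p]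
  exact dist_le _

theorem SimpleGraph.Connected.dist_iso (hG : G.Connected) (f : G ≃g H) (u v : V) :
    H.dist (f u) (f v) = G.dist u v := by
  refine le_antisymm (hG.dist_map_le f.toHom u v) ?_
  have := (f.connected_iff.mp hG).dist_map_le f.symm.toHom (f u) (f v)
  simpa using this

theorem closerCount_iso (hG : G.Connected) (f : G ≃g H) (u v : V) :
    closerCount H (f u) (f v) = closerCount G u v := by
  have : {w | H.dist w (f u) < H.dist w (f v)} = f '' {w | G.dist w u < G.dist w v} := by
    ext w
    obtain ⟨w, rfl⟩ := f.surjective w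
    simp [hG.dist_iso f, f.injective.eq_iff]
  rw [closerCount, this, Set.ncard_image_of_injective _ f.injective, closerCount]

theorem mostarIndex_iso [Fintype V] [Fintype W] (hG : G.Connected) (f : G ≃g H) :
    mostarIndex G = mostarIndex H := by
  classical
  refine sum_nbij' (Sym2.map f) (Sym2.map f.symm) ?_ ?_ ?_ ?_ ?_
  · intro e
    induction e with | h u v => simp [f.map_adj_iff]
  · intro e
    induction e with | h u v => simp [f.symm.map_adj_iff]
  · intro e _
    induction e with | h u v => simp
  · intro e _
    induction e with | h u v => simp
  · intro e _
    induction e with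
    | h u v =>
      rw [Sym2.map_mk, edgeImbalance_mk, edgeImbalance_mk, closerCount_iso hG f,
        closerCount_iso hG f]

/-- A bijective homomorphism between finite trees is an isomorphism. -/
theorem SimpleGraph.IsTree.nonempty_iso_of_bijective [Finite V] (hG : G.IsTree) (hH : H.IsTree)
    (f : G →g H) (hf : Function.Bijective f) : Nonempty (G ≃g H) := by
  let e := Equiv.ofBijective f hf
  have i : H.comap e ≃g H := Iso.comap e H
  have hle : G ≤ H.comap e := fun a b hab => f.map_adj hab
  -- Trees are maximal acyclic graphs, so the acyclic pullback of `H`, which contains `G`, equals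
  -- `G`.
  have hmax := (isTree_iff_maximal_isAcyclic.mp hG).2
  have : H.comap e = G :=
    le_antisymm (hmax.2 (i.isTree_iff.mpr hH).isAcyclic hle) hle
  exact ⟨this ▸ i⟩

end Iso

/-! ### The upper bound and the star. -/

section Star

variable {V : Type*} {T : SimpleGraph V}

theorem edgeImbalance_starGraph [Fintype V] {c w : V} (hw : w ≠ c) :
    edgeImbalance (starGraph c) s(w, c) = |2 - (Fintype.card V : ℤ)| := by
  rw [edgeImbalance_eq_of_cut (S := {w}) ?_ (connected_starGraph c) rfl (by simpa using hw.symm)]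
  · simp
  · rintro x y hxy rfl hy
    rw [starGraph_adj] at hxy
    exact ⟨rfl, hxy.2.resolve_left hw⟩

theorem mostarIndex_starGraph [Fintype V] (c : V) (hV : 2 ≤ Fintype.card V) :
    mostarIndex (starGraph c) = ((Fintype.card V : ℤ) - 1) * (Fintype.card V - 2) := by
  classical
  have hcard := (isTree_starGraph c).card_edgeFinset
  rw [mostarIndex_eq_sum, sum_congr rfl (g := fun _ => (Fintype.card V : ℤ) - 2), sum_const,
    nsmul_eq_mul]
  · rw [← hcard]
    push_cast
    ring
  · intro e
    have h2 : |2 - (Fintype.card V : ℤ)| = Fintype.card V - 2 := by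
      rw [abs_sub_comm, abs_of_nonneg]
      omega
    induction e with
    | h u v =>
      intro he
      rw [mem_edgeFinset, mem_edgeSet, starGraph_adj] at he
      obtain ⟨hne, rfl | rfl⟩ := he
      · rw [Sym2.eq_swap, edgeImbalance_starGraph hne.symm, h2]
      · rw [edgeImbalance_starGraph hne, h2]

theorem SimpleGraph.IsTree.mostarIndex_le [Fintype V] (hT : T.IsTree) :
    mostarIndex T ≤ ((Fintype.card V : ℤ) - 1) * (Fintype.card V - 2) ∧
    (mostarIndex T = ((Fintype.card V : ℤ) - 1) * (Fintype.card V - 2) →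
      ∀ u v, T.Adj u v → closerCount T u v = 1 ∨ closerCount T v u = 1) := by
  classical
  have hcard := hT.card_edgeFinset
  have hsum : ((Fintype.card V : ℤ) - 1) * (Fintype.card V - 2) =
      ∑ e ∈ T.edgeFinset, ((Fintype.card V : ℤ) - 2) := by
    rw [sum_const, nsmul_eq_mul]
    congr 1
    omega
  have hle : ∀ e ∈ T.edgeFinset, edgeImbalance T e ≤ (Fintype.card V : ℤ) - 2 := by
    intro e
    induction e with
    | h u v =>
      intro he
      exact (edgeImbalance_le (by simpa using he)).1
  rw [mostarIndex_eq_sum, hsum]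
  refine ⟨sum_le_sum hle, fun heq u v huv => ?_⟩
  exact (edgeImbalance_le huv).2
    ((sum_eq_sum_iff_of_le hle).mp heq s(u, v) (by simpa using huv))

theorem SimpleGraph.IsTree.eq_of_closerCount_eq_one [Finite V] (hT : T.IsTree) {u v w : V}
    (huv : T.Adj u v) (h : closerCount T u v = 1) (hw : T.Adj u w) : w = v := by
  by_contra hne
  obtain ⟨a, ha⟩ := Set.ncard_eq_one.mp h
  have h1 : u ∈ ({a} : Set V) := by
    rw [← ha]
    simp [dist_eq_one_iff_adj.mpr huv]
  have h2 : w ∈ ({a} : Set V) := by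
    rw [← ha, Set.mem_ofPred_eq, dist_eq_one_iff_adj.mpr hw.symm]
    -- Adjacent vertices of a tree differ in distance to `v`, so a second neighbour `w` of `u` is at
    -- distance at least two from `v` and would be counted too.
    have h3 := hT.dist_ne_of_adj v hw
    rw [dist_eq_one_iff_adj.mpr huv.symm, T.dist_comm] at h3
    have h4 : T.dist w v ≠ 0 := by
      rw [Ne, hT.connected.dist_eq_zero_iff]
      exact hne
    omega
  exact hw.ne (h1.trans h2.symm)

/-- The centre is a vertex of maximal degree: if it is itself the leaf end of an edge, maximality
makes the other end a leaf as well. So all its neighbours are leaves, and connectedness leaves no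
other vertices. -/
theorem SimpleGraph.Connected.exists_eq_starGraph [Fintype V] [Nonempty V] (hT : T.Connected)
    (hleaf : ∀ u v, T.Adj u v → (∀ w, T.Adj u w → w = v) ∨ (∀ w, T.Adj v w → w = u)) :
    ∃ c, T = starGraph c := by
  classical
  obtain ⟨c, -, hc⟩ := exists_max_image univ (fun v => T.degree v) univ_nonempty
  have hN : ∀ v, T.Adj c v → ∀ w, T.Adj v w → w = c := by
    intro v hv
    rcases hleaf c v hv with h | h
    · have hdeg : T.degree v ≤ 1 := (hc v (mem_univ _)).trans
        (card_le_one.mpr fun a ha b hb => by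
          rw [h a (by simpa using ha), h b (by simpa using hb)])
      exact fun w hw => card_le_one.mp hdeg w (by simpa using hw) c (by simpa using hv.symm)
    · exact h
  have hall : ∀ v, v = c ∨ T.Adj c v := by
    intro v
    obtain ⟨p⟩ := hT v c
    induction p with
    | nil => exact Or.inl rfl
    | @cons a b c hab p ih =>
      rcases ih hc hN with rfl | h
      · exact Or.inr hab.symm
      · exact Or.inl (hN b h a hab.symm)
  refine ⟨c, ?_⟩
  ext x y
  rw [starGraph_adj]
  constructor
  · intro h
    refine ⟨h.ne, ?_⟩
    rcases hall x with rfl | hx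
    · exact Or.inl rfl
    · exact Or.inr (hN x hx y h)
  · rintro ⟨hne, rfl | rfl⟩
    · exact (hall y).resolve_left hne.symm
    · exact ((hall x).resolve_left hne).symm

theorem SimpleGraph.IsTree.mostarIndex_eq_iff [Fintype V] (hT : T.IsTree) (hV : 2 ≤ Fintype.card V) :
    mostarIndex T = ((Fintype.card V : ℤ) - 1) * (Fintype.card V - 2) ↔ ∃ c, T = starGraph c := by
  have := hT.connected.nonempty
  refine ⟨fun h => hT.connected.exists_eq_starGraph fun u v huv => ?_, ?_⟩
  · exact (hT.mostarIndex_le.2 h u v huv).imp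
      (fun h w hw => hT.eq_of_closerCount_eq_one huv h hw)
      (fun h w hw => hT.eq_of_closerCount_eq_one huv.symm h hw)
  · rintro ⟨c, rfl⟩
    exact mostarIndex_starGraph c hV

theorem nonempty_iso_starGraph {W : Type*} [Fintype V] [Fintype W]
    (h : Fintype.card V = Fintype.card W) (c : V) (c' : W) :
    Nonempty (starGraph c ≃g starGraph c') := by
  classical
  let e := Fintype.equivOfCardEq h
  let e' := e.trans (Equiv.swap (e c) c')
  have he : e' c = c' := by simp [e']
  refine ⟨⟨e', fun {a b} => ?_⟩⟩
  rw [starGraph_adj, starGraph_adj, ← he]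
  simp only [ne_eq, EmbeddingLike.apply_eq_iff_eq]

theorem isOddTree_starTree (n : ℕ) (hn : 0 < 2 * n) : IsOddTree (2 * n) (starTree (2 * n) hn) := by
  classical
  refine ⟨isTree_starGraph _, by simp, fun v => ?_⟩
  by_cases hv : v = ⟨0, hn⟩
  · have := degree_starGraph_center (r := (⟨0, hn⟩ : Fin (2 * n)))
    rw [hv, starTree]
    have h2 : Odd (Fintype.card (Fin (2 * n)) - 1) := by
      rw [Fintype.card_fin]
      exact ⟨n - 1, by omega⟩
    rw [← this] at h2
    convert h2
  · have := degree_starGraph_of_ne_center hv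
    have h2 : Odd 1 := odd_one
    rw [← this] at h2
    rw [starTree]
    convert h2

end Star

/-! ### Spines and distances to the middle of a diametral path. -/

/-- A spine of `T`: a diametral path `p 0, …, p d` together with a neighbour `q i` off the path of
each inner vertex `p i`. -/
structure IsSpine {V : Type*} (T : SimpleGraph V) (d : ℕ) (p q : ℕ → V) : Prop where
  adj_succ : ∀ i < d, T.Adj (p i) (p (i + 1))
  dist_ends : T.dist (p 0) (p d) = d
  dist_le : ∀ u v, T.dist u v ≤ d
  adj_pendent : ∀ i, 1 ≤ i → i < d → T.Adj (p i) (q i)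
  ne_pred : ∀ i, 1 ≤ i → i < d → q i ≠ p (i - 1)
  ne_succ : ∀ i, 1 ≤ i → i < d → q i ≠ p (i + 1)

section Spine

variable {V : Type*} {T : SimpleGraph V} {d : ℕ} {p q : ℕ → V}

theorem SimpleGraph.Connected.dist_le_of_forall_adj (hT : T.Connected)
    (hadj : ∀ i < d, T.Adj (p i) (p (i + 1))) {i j : ℕ} (hij : i ≤ j) (hj : j ≤ d) :
    T.dist (p i) (p j) ≤ j - i := by
  induction j, hij using Nat.le_induction with
  | base => simp
  | succ j hij ih =>
    have h1 := ih (by omega)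
    have h2 := hT.dist_triangle (u := p i) (v := p j) (w := p (j + 1))
    have h3 : T.dist (p j) (p (j + 1)) = 1 := dist_eq_one_iff_adj.mpr (hadj j (by omega))
    omega

theorem SimpleGraph.Connected.dist_eq_of_forall_adj (hT : T.Connected)
    (hadj : ∀ i < d, T.Adj (p i) (p (i + 1))) (hd : T.dist (p 0) (p d) = d)
    {i j : ℕ} (hij : i ≤ j) (hj : j ≤ d) : T.dist (p i) (p j) = j - i := by
  have h1 := hT.dist_le_of_forall_adj hadj (Nat.zero_le i) (by omega)
  have h2 := hT.dist_le_of_forall_adj hadj hij hj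
  have h3 := hT.dist_le_of_forall_adj hadj hj le_rfl
  have h4 := hT.dist_triangle (u := p 0) (v := p i) (w := p d)
  have h5 := hT.dist_triangle (u := p i) (v := p j) (w := p d)
  omega

theorem SimpleGraph.IsTree.exists_isSpine [Fintype V] [DecidableRel T.Adj] (hT : T.IsTree)
    (hodd : ∀ v, Odd (T.degree v)) : ∃ d p q, IsSpine T d p q := by
  classical
  have := hT.connected.nonempty
  obtain ⟨⟨a, b⟩, -, hab⟩ := exists_max_image (univ : Finset (V × V)) (fun x => T.dist x.1 x.2)
    univ_nonempty
  obtain ⟨w, hw⟩ := hT.connected.exists_walk_length_eq_dist a b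
  have hadj : ∀ i < w.length, T.Adj (w.getVert i) (w.getVert (i + 1)) :=
    fun i hi => w.adj_getVert_succ hi
  have hd : T.dist (w.getVert 0) (w.getVert w.length) = w.length := by
    rw [Walk.getVert_zero, Walk.getVert_length, hw]
  have hq : ∀ i, ∃ x, 1 ≤ i → i < w.length → T.Adj (w.getVert i) x ∧
      x ≠ w.getVert (i - 1) ∧ x ≠ w.getVert (i + 1) := by
    intro i
    by_cases hi : 1 ≤ i ∧ i < w.length
    swap
    -- Outside the inner range `q` is never used; `a` is a default value.
    · exact ⟨a, fun h h' => absurd ⟨h, h'⟩ hi⟩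
    have h1 : T.Adj (w.getVert i) (w.getVert (i - 1)) := by
      have := hadj (i - 1) (by omega)
      rw [Nat.sub_add_cancel hi.1] at this
      exact this.symm
    have h2 := hadj i hi.2
    have hne : w.getVert (i - 1) ≠ w.getVert (i + 1) := by
      intro h
      have := hT.connected.dist_eq_of_forall_adj hadj hd (i := i - 1) (j := i + 1) (by omega)
        (by omega)
      rw [h, dist_self] at this
      omega
    have hsub : {w.getVert (i - 1), w.getVert (i + 1)} ⊆ T.neighborFinset (w.getVert i) := by
      intro x hx
      rw [mem_insert, mem_singleton] at hx
      rcases hx with rfl | rfl <;> simpa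
    have hcard : #{w.getVert (i - 1), w.getVert (i + 1)} = 2 := card_pair hne
    -- The two path neighbours cannot be all, since the degree is odd.
    have hlt : #{w.getVert (i - 1), w.getVert (i + 1)} < #(T.neighborFinset (w.getVert i)) := by
      refine lt_of_le_of_ne (card_le_card hsub) fun h => ?_
      have := hodd (w.getVert i)
      rw [degree, ← h, hcard] at this
      exact absurd this (by decide)
    obtain ⟨x, hx, hx'⟩ := exists_mem_notMem_of_card_lt_card hlt
    rw [mem_insert, mem_singleton, not_or] at hx'
    exact ⟨x, fun _ _ => ⟨by simpa using hx, hx'⟩⟩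
  choose q hq using hq
  refine ⟨w.length, w.getVert, q, hadj, hd, fun u v => ?_, fun i h h' => (hq i h h').1,
    fun i h h' => (hq i h h').2.1, fun i h h' => (hq i h h').2.2⟩
  rw [hw]
  exact hab (u, v) (mem_univ _)

namespace IsSpine

theorem dist_eq (hs : IsSpine T d p q) (hT : T.IsTree) {i j : ℕ} (hij : i ≤ j) (hj : j ≤ d) :
    T.dist (p i) (p j) = j - i :=
  hT.connected.dist_eq_of_forall_adj hs.adj_succ hs.dist_ends hij hj

theorem dist_left (hs : IsSpine T d p q) (hT : T.IsTree) {i : ℕ} (hi : i ≤ d) :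
    T.dist (p 0) (p i) = i := by
  simpa using hs.dist_eq hT (Nat.zero_le i) hi

/-- Otherwise `q i` would be the unique neighbour of `p i` closer to `p 0`, which is `p (i - 1)`. -/
theorem dist_pendent_left (hs : IsSpine T d p q) (hT : T.IsTree) {i : ℕ} (h1 : 1 ≤ i)
    (hi : i < d) : T.dist (p 0) (q i) = i + 1 := by
  have h2 := hs.dist_left hT hi.le
  have h3 := hs.dist_left hT (i := i - 1) (by omega)
  have hadj : T.Adj (p i) (p (i - 1)) := by
    have := hs.adj_succ (i - 1) (by omega)
    rw [Nat.sub_add_cancel h1] at this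
    exact this.symm
  have h4 := hT.dist_eq_dist_add_one_of_adj (p 0) (hs.adj_pendent i h1 hi)
  by_contra hne
  exact hs.ne_pred i h1 hi (hT.eq_of_adj_of_dist_lt (c := p 0) (hs.adj_pendent i h1 hi) hadj
    (by omega) (by omega))

theorem dist_pendent_right (hs : IsSpine T d p q) (hT : T.IsTree) {i : ℕ} (h1 : 1 ≤ i)
    (hi : i < d) : T.dist (p d) (q i) = d - i + 1 := by
  have h2 := hs.dist_eq hT hi.le le_rfl
  have h3 := hs.dist_eq hT (i := i + 1) hi le_rfl
  rw [T.dist_comm] at h2 h3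
  have h4 := hT.dist_eq_dist_add_one_of_adj (p d) (hs.adj_pendent i h1 hi)
  by_contra hne
  exact hs.ne_succ i h1 hi (hT.eq_of_adj_of_dist_lt (c := p d) (hs.adj_pendent i h1 hi)
    (hs.adj_succ i hi) (by omega) (by omega))

theorem path_inj (hs : IsSpine T d p q) (hT : T.IsTree) {i j : ℕ} (hi : i ≤ d) (hj : j ≤ d)
    (h : p i = p j) : i = j := by
  rw [← hs.dist_left hT hi, h, hs.dist_left hT hj]

theorem pendent_inj (hs : IsSpine T d p q) (hT : T.IsTree) {i j : ℕ} (hi : 1 ≤ i) (hi' : i < d)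
    (hj : 1 ≤ j) (hj' : j < d) (h : q i = q j) : i = j := by
  have h1 := hs.dist_pendent_left hT hi hi'
  have h2 := hs.dist_pendent_left hT hj hj'
  rw [h] at h1
  omega

/-- The distances to the two ends add up to `d` on the path and to `d + 2` at a pendent vertex. -/
theorem path_ne_pendent (hs : IsSpine T d p q) (hT : T.IsTree) {i j : ℕ} (hi : i ≤ d)
    (hj : 1 ≤ j) (hj' : j < d) : p i ≠ q j := by
  intro h
  have h1 := hs.dist_pendent_left hT hj hj'
  have h2 := hs.dist_pendent_right hT hj hj'
  have h3 := hs.dist_left hT hi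
  have h4 := hs.dist_eq hT hi le_rfl
  rw [← h] at h1 h2
  rw [T.dist_comm] at h4
  omega

/-- The distance to a fixed vertex decreases along the path up to some point, then increases. -/
theorem dist_eq_or (hs : IsSpine T d p q) (hT : T.IsTree) (v : V) {j : ℕ} (hj : j ≤ d) :
    T.dist v (p j) + j = T.dist v (p 0) ∨ T.dist v (p j) + (d - j) = T.dist v (p d) := by
  have hstep : ∀ i < d, T.dist v (p i) = T.dist v (p (i + 1)) + 1 ∨
      T.dist v (p (i + 1)) = T.dist v (p i) + 1 :=
    fun i hi => hT.dist_eq_dist_add_one_of_adj v (hs.adj_succ i hi)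
  -- A rise followed by a fall would give `p (i + 1)` two neighbours closer to `v`.
  have hconv : ∀ i, i + 2 ≤ d → T.dist v (p (i + 1)) = T.dist v (p i) + 1 →
      T.dist v (p (i + 2)) = T.dist v (p (i + 1)) + 1 := by
    intro i hi h
    refine (hstep (i + 1) (by omega)).resolve_left fun h' => ?_
    have h1 := hT.eq_of_adj_of_dist_lt (c := v) (hs.adj_succ i (by omega)).symm
      (hs.adj_succ (i + 1) (by omega)) (by omega) (by omega)
    have := hs.path_inj hT (by omega) (by omega) h1
    omega
  have hup : ∀ i < d, T.dist v (p (i + 1)) = T.dist v (p i) + 1 → ∀ k, i + 1 ≤ k → k ≤ d →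
      T.dist v (p k) = T.dist v (p i) + (k - i) ∧ T.dist v (p k) = T.dist v (p (k - 1)) + 1 := by
    intro i hi h k hk
    induction k, hk using Nat.le_induction with
    | base => intro _; rw [h]; simp
    | succ k hk ih =>
      intro hk'
      obtain ⟨h1, h2⟩ := ih (by omega)
      have h3 := hconv (k - 1) (by omega) (by rw [Nat.sub_add_cancel (by omega)]; exact h2)
      rw [show k - 1 + 2 = k + 1 by omega, show k - 1 + 1 = k by omega] at h3
      rw [Nat.add_sub_cancel]
      omega
  by_cases hex : ∃ i < j, T.dist v (p (i + 1)) = T.dist v (p i) + 1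
  · obtain ⟨i, hi, h⟩ := hex
    have h1 := (hup i (by omega) h j hi hj).1
    have h2 := (hup i (by omega) h d (by omega) le_rfl).1
    omega
  · push Not at hex
    left
    have hdown : ∀ k ≤ j, T.dist v (p k) + k = T.dist v (p 0) := by
      intro k
      induction k with
      | zero => simp
      | succ k ih =>
        intro hk
        have h1 := ih (by omega)
        have h2 := (hstep k (by omega)).resolve_right (hex k (by omega))
        omega
    exact hdown j le_rfl

/-- Since `d` is the diameter, each middle vertex is within `d - d / 2` of `v`. For even `d` this
suffices; for odd `d` the two distances differ by exactly one, which saves the missing unit. -/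
theorem dist_add_dist_le (hs : IsSpine T d p q) (hT : T.IsTree) (v : V) :
    T.dist v (p (d / 2)) + T.dist v (p (d - d / 2)) ≤ d := by
  have h0 := hs.dist_le v (p 0)
  have hd := hs.dist_le v (p d)
  have h1 := hs.dist_eq_or hT v (j := d / 2) (by omega)
  have h2 := hs.dist_eq_or hT v (j := d - d / 2) (by omega)
  rcases Nat.even_or_odd' d with ⟨k, hk | hk⟩
  · rw [show d - d / 2 = d / 2 by omega] at h2 ⊢
    omega
  · have h3 := hT.dist_eq_dist_add_one_of_adj v (hs.adj_succ (d / 2) (by omega))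
    rw [show d / 2 + 1 = d - d / 2 by omega] at h3
    omega

theorem dist_path_add_dist_path (hs : IsSpine T d p q) (hT : T.IsTree) {i : ℕ} (hi : i ≤ d) :
    (T.dist (p i) (p (d / 2)) + T.dist (p i) (p (d - d / 2)) : ℤ) = |2 * (i : ℤ) - d| := by
  have key : ∀ j ≤ d, (T.dist (p i) (p j) : ℤ) = |(i : ℤ) - j| := by
    intro j hj
    rcases le_total i j with h | h
    · have := hs.dist_eq hT h hj
      rw [abs_of_nonpos (by omega)]
      omega
    · have := hs.dist_eq hT h hi
      rw [T.dist_comm] at this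
      rw [abs_of_nonneg (by omega)]
      omega
  rw [key _ (by omega), key _ (by omega)]
  have h1 := abs_cases ((i : ℤ) - (d / 2 : ℕ))
  have h2 := abs_cases ((i : ℤ) - (d - d / 2 : ℕ))
  have h3 := abs_cases (2 * (i : ℤ) - d)
  omega

theorem dist_pendent_add_dist_pendent_le (hs : IsSpine T d p q) (hT : T.IsTree) {i : ℕ}
    (h1 : 1 ≤ i) (hi : i < d) :
    (T.dist (q i) (p (d / 2)) + T.dist (q i) (p (d - d / 2)) : ℤ) ≤ |2 * (i : ℤ) - d| + 2 := by
  have h2 := hs.dist_path_add_dist_path hT hi.le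
  have h3 : T.dist (q i) (p i) = 1 := dist_eq_one_iff_adj.mpr (hs.adj_pendent i h1 hi).symm
  have h4 := hT.connected.dist_triangle (u := q i) (v := p i) (w := p (d / 2))
  have h5 := hT.connected.dist_triangle (u := q i) (v := p i) (w := p (d - d / 2))
  omega

theorem two_mul_le_card [Fintype V] (hs : IsSpine T d p q) (hT : T.IsTree) :
    2 * d ≤ Fintype.card V := by
  classical
  have h1 : #((range (d + 1)).image p ∪ (Ico 1 d).image q) =
      #(range (d + 1)) + #(Ico 1 d) := by
    rw [card_union_of_disjoint, card_image_of_injOn, card_image_of_injOn]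
    · intro i hi j hj h
      rw [coe_Ico, Set.mem_Ico] at hi hj
      exact hs.pendent_inj hT hi.1 hi.2 hj.1 hj.2 h
    · intro i hi j hj h
      rw [coe_range, Set.mem_Iio] at hi hj
      exact hs.path_inj hT (by omega) (by omega) h
    · rw [Finset.disjoint_left]
      intro x hx hx'
      obtain ⟨i, hi, rfl⟩ := mem_image.mp hx
      obtain ⟨j, hj, h⟩ := mem_image.mp hx'
      rw [mem_range] at hi
      rw [mem_Ico] at hj
      exact hs.path_ne_pendent hT (by omega) hj.1 hj.2 h.symm
  have h2 := card_le_univ ((range (d + 1)).image p ∪ (Ico 1 d).image q)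
  rw [h1, card_range, Nat.card_Ico] at h2
  omega

theorem sum_dist_le [Fintype V] (hs : IsSpine T d p q) (hT : T.IsTree) :
    ∑ v, (T.dist v (p (d / 2)) + T.dist v (p (d - d / 2)) : ℤ) ≤ (Fintype.card V : ℤ) * d -
      ∑ i ∈ range (d + 1), ((d : ℤ) - |2 * (i : ℤ) - d|) -
      ∑ i ∈ Ico 1 d, ((d : ℤ) - |2 * (i : ℤ) - d| - 2) := by
  classical
  -- The slack `h` is nonnegative, so vertices off the spine may be dropped from its sum.
  set h : V → ℤ := fun v => d - (T.dist v (p (d / 2)) + T.dist v (p (d - d / 2)) : ℤ) with hh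
  have hnn : ∀ v, 0 ≤ h v := by
    intro v
    have := hs.dist_add_dist_le hT v
    simp only [hh]
    omega
  have hdisj : Disjoint ((range (d + 1)).image p) ((Ico 1 d).image q) := by
    rw [Finset.disjoint_left]
    intro x hx hx'
    obtain ⟨i, hi, rfl⟩ := mem_image.mp hx
    obtain ⟨j, hj, h⟩ := mem_image.mp hx'
    rw [mem_range] at hi
    rw [mem_Ico] at hj
    exact hs.path_ne_pendent hT (by omega) hj.1 hj.2 h.symm
  have h1 : ∑ v ∈ (range (d + 1)).image p ∪ (Ico 1 d).image q, h v ≤ ∑ v, h v :=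
    sum_le_sum_of_subset_of_nonneg (subset_univ _) fun v _ _ => hnn v
  rw [sum_union hdisj, sum_image, sum_image] at h1
  rotate_left
  · intro i hi j hj h
    rw [coe_Ico, Set.mem_Ico] at hi hj
    exact hs.pendent_inj hT hi.1 hi.2 hj.1 hj.2 h
  · intro i hi j hj h
    rw [coe_range, Set.mem_Iio] at hi hj
    exact hs.path_inj hT (by omega) (by omega) h
  have h2 : ∑ i ∈ range (d + 1), ((d : ℤ) - |2 * (i : ℤ) - d|) = ∑ i ∈ range (d + 1), h (p i) := by
    refine sum_congr rfl fun i hi => ?_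
    rw [mem_range] at hi
    simp only [hh]
    rw [hs.dist_path_add_dist_path hT (by omega)]
  have h3 : ∑ i ∈ Ico 1 d, ((d : ℤ) - |2 * (i : ℤ) - d| - 2) ≤ ∑ i ∈ Ico 1 d, h (q i) := by
    refine sum_le_sum fun i hi => ?_
    rw [mem_Ico] at hi
    have := hs.dist_pendent_add_dist_pendent_le hT hi.1 hi.2
    simp only [hh]
    omega
  have h4 : ∑ v, h v = (Fintype.card V : ℤ) * d -
      ∑ v, (T.dist v (p (d / 2)) + T.dist v (p (d - d / 2)) : ℤ) := by
    simp only [hh]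
    rw [sum_sub_distrib, sum_const, nsmul_eq_mul, card_univ]
  linarith

end IsSpine

end Spine

/-! ### Evaluating the bound in terms of `d`. -/

section Sums

/-- From `d` to `d + 2` the old terms reappear shifted by one index, with two new end terms `d + 2`.
The parity term is `1` exactly for even `d`. -/
theorem two_mul_sum_abs (d : ℕ) :
    2 * ∑ i ∈ range (d + 1), |2 * (i : ℤ) - d| + ((d + 1) % 2 : ℕ) = ((d : ℤ) + 1) ^ 2 := by
  induction d using Nat.twoStepInduction with
  | zero => simp
  | one => simp [sum_range_succ]
  | more d ih _ =>
    rw [sum_range_succ, sum_range_succ']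
    have h1 : ∑ i ∈ range (d + 1), |2 * ((i + 1 : ℕ) : ℤ) - (d + 2 : ℕ)| =
        ∑ i ∈ range (d + 1), |2 * (i : ℤ) - d| := by
      refine sum_congr rfl fun i _ => ?_
      congr 1
      push_cast
      ring
    have h2 : |2 * ((0 : ℕ) : ℤ) - (d + 2 : ℕ)| = d + 2 := by
      rw [abs_of_nonpos (by omega)]
      push_cast
      ring
    have h3 : |2 * ((d + 1 + 1 : ℕ) : ℤ) - (d + 2 : ℕ)| = d + 2 := by
      rw [abs_of_nonneg (by omega)]
      push_cast
      ring
    have h4 : (d + 2 + 1) % 2 = (d + 1) % 2 := by omega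
    rw [h1, h2, h3, h4]
    push_cast at ih ⊢
    linarith

theorem IsSpine.mostarIndex_ge {V : Type*} [Fintype V] {T : SimpleGraph V} {d : ℕ} {p q : ℕ → V}
    (hs : IsSpine T d p q) (hT : T.IsTree) (hd : 0 < d) :
    (Fintype.card V : ℤ) * (Fintype.card V - 1) + ((d + 1) % 2 : ℕ) + ((d : ℤ) - 1) ^ 2 ≤
      mostarIndex T + (Fintype.card V : ℤ) * d := by
  have h1 := hT.le_mostarIndex_add_sum_dist (p (d / 2))
  have h2 := hT.le_mostarIndex_add_sum_dist (p (d - d / 2))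
  have h3 := hs.sum_dist_le hT
  have h4 := two_mul_sum_abs d
  have h5 : ∑ i ∈ range (d + 1), |2 * (i : ℤ) - d| = 2 * d + ∑ i ∈ Ico 1 d, |2 * (i : ℤ) - d| := by
    rw [sum_range_succ, range_eq_Ico, sum_eq_sum_Ico_succ_bot hd, Nat.cast_zero, mul_zero,
      zero_sub, abs_neg, Nat.abs_cast, show 2 * (d : ℤ) - d = d by ring, Nat.abs_cast]
    ring
  have h6 : ((d - 1 : ℕ) : ℤ) = d - 1 := by omega
  simp only [sum_sub_distrib, sum_add_distrib, sum_const, nsmul_eq_mul, card_range, Nat.card_Ico,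
    h6] at h3
  push_cast at h3
  nlinarith

end Sums

/-! ### The caterpillar and the lower bound. -/

section Caterpillar

variable {n : ℕ}

/-- The path vertex `v_{i+1}` of `C_{2n,0,n-1}`. -/
def caterpillarPath (i : ℕ) (hi : i < 2 * n - 0 - (n - 1)) : CaterpillarVertex (2 * n) 0 (n - 1) :=
  .inl ⟨i, hi⟩

/-- The pendent vertex of `C_{2n,0,n-1}` attached to `v_{i+2}`. -/
def caterpillarPendent (i : ℕ) (hi : i < n - 1) : CaterpillarVertex (2 * n) 0 (n - 1) :=
  .inr (.inr ⟨i, hi⟩)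

theorem caterpillarVertex_cases {P : CaterpillarVertex (2 * n) 0 (n - 1) → Prop}
    (h1 : ∀ i hi, P (caterpillarPath i hi)) (h2 : ∀ i hi, P (caterpillarPendent i hi)) :
    ∀ x, P x := by
  rintro (⟨i, hi⟩ | ⟨i, hi⟩ | ⟨i, hi⟩)
  · exact h1 i hi
  · exact absurd hi (Nat.not_lt_zero i)
  · exact h2 i hi

theorem caterpillarPath_inj {i j : ℕ} {hi : i < 2 * n - 0 - (n - 1)} {hj : j < 2 * n - 0 - (n - 1)} :
    caterpillarPath i hi = caterpillarPath j hj ↔ i = j := by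
  simp [caterpillarPath]

theorem caterpillarPendent_inj {i j : ℕ} {hi : i < n - 1} {hj : j < n - 1} :
    caterpillarPendent i hi = caterpillarPendent j hj ↔ i = j := by
  simp [caterpillarPendent]

theorem caterpillarPath_ne {i j : ℕ} {hi : i < 2 * n - 0 - (n - 1)} {hj : j < n - 1} :
    caterpillarPath i hi ≠ caterpillarPendent j hj := by
  simp [caterpillarPath, caterpillarPendent]

theorem caterpillarPendent_ne {i j : ℕ} {hi : i < n - 1} {hj : j < 2 * n - 0 - (n - 1)} :
    caterpillarPendent i hi ≠ caterpillarPath j hj :=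
  caterpillarPath_ne.symm

theorem caterpillar_adj_path_path {i j : ℕ} {hi : i < 2 * n - 0 - (n - 1)} {hj : j < 2 * n - 0 - (n - 1)} :
    (caterpillar (2 * n) 0 (n - 1)).Adj (caterpillarPath i hi) (caterpillarPath j hj) ↔
      i + 1 = j ∨ j + 1 = i := by
  rw [caterpillar, fromRel_adj, Ne, caterpillarPath_inj]
  change (¬ i = j ∧ (i + 1 = j ∨ j + 1 = i)) ↔ _
  exact ⟨fun h => h.2, fun h => ⟨by omega, h⟩⟩

theorem caterpillar_adj_path_pendent {i j : ℕ} {hi : i < 2 * n - 0 - (n - 1)} {hj : j < n - 1} :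
    (caterpillar (2 * n) 0 (n - 1)).Adj (caterpillarPath i hi) (caterpillarPendent j hj) ↔
      i = j + 1 := by
  rw [caterpillar, fromRel_adj, and_iff_right caterpillarPath_ne]
  change (i + 1 + 0 + 2 * (n - 1) = 2 * n + j ∨ False) ↔ i = j + 1
  rw [or_false, Nat.add_zero]
  omega

theorem caterpillar_adj_pendent_path {i j : ℕ} {hi : i < 2 * n - 0 - (n - 1)} {hj : j < n - 1} :
    (caterpillar (2 * n) 0 (n - 1)).Adj (caterpillarPendent j hj) (caterpillarPath i hi) ↔
      i = j + 1 := by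
  rw [adj_comm, caterpillar_adj_path_pendent]

theorem caterpillar_adj_pendent_pendent {i j : ℕ} {hi : i < n - 1} {hj : j < n - 1} :
    ¬ (caterpillar (2 * n) 0 (n - 1)).Adj (caterpillarPendent i hi) (caterpillarPendent j hj) := by
  rw [caterpillar, fromRel_adj]
  rintro ⟨-, h | h⟩ <;> exact h

/-- The map from `C_{2n,0,n-1}` given by a path and pendent vertices. -/
def caterpillarMap {V : Type*} (p q : ℕ → V) : CaterpillarVertex (2 * n) 0 (n - 1) → V :=
  Sum.elim (fun i => p i) (Sum.elim (fun i => i.elim0) (fun i => q (i + 1)))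

/-- The homomorphism from `C_{2n,0,n-1}` given by a path and neighbours of its inner vertices. -/
def caterpillarHom {V : Type*} {T : SimpleGraph V} (p q : ℕ → V)
    (hp : ∀ i < n, T.Adj (p i) (p (i + 1))) (hq : ∀ i, 1 ≤ i → i < n → T.Adj (p i) (q i)) :
    caterpillar (2 * n) 0 (n - 1) →g T where
  toFun := caterpillarMap p q
  map_rel' := by
    suffices h : ∀ x y, (caterpillar (2 * n) 0 (n - 1)).Adj x y →
        T.Adj (caterpillarMap p q x) (caterpillarMap p q y) from
      fun {x y} hxy => h x y hxy
    refine caterpillarVertex_cases (fun i hi => ?_) (fun i hi => ?_) <;>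
      refine caterpillarVertex_cases (fun j hj => ?_) (fun j hj => ?_)
    · rw [caterpillar_adj_path_path]
      rintro (rfl | rfl)
      · exact hp i (by omega)
      · exact (hp j (by omega)).symm
    · rw [caterpillar_adj_path_pendent]
      rintro rfl
      exact hq (j + 1) (by omega) (by omega)
    · rw [caterpillar_adj_pendent_path]
      rintro rfl
      exact (hq (i + 1) (by omega) (by omega)).symm
    · exact fun h => absurd h caterpillar_adj_pendent_pendent

theorem card_caterpillarVertex (hn : 0 < n) :
    Fintype.card (CaterpillarVertex (2 * n) 0 (n - 1)) = 2 * n := by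
  simp only [Fintype.card_sum, Fintype.card_fin]
  omega

/-- The path edge `v_{i+1} v_{i+2}` of `C_{2n,0,n-1}`. -/
def caterpillarPathEdge (i : Fin n) : Sym2 (CaterpillarVertex (2 * n) 0 (n - 1)) :=
  s(caterpillarPath i (by omega), caterpillarPath (i + 1) (by omega))

/-- The pendent edge of `C_{2n,0,n-1}` at `v_{i+2}`. -/
def caterpillarPendentEdge (i : Fin (n - 1)) : Sym2 (CaterpillarVertex (2 * n) 0 (n - 1)) :=
  s(caterpillarPath (i + 1) (by omega), caterpillarPendent i i.2)

-- Inclusion is enough: it bounds the number of edges for the tree property, and the Mostar index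
-- from above because imbalances are nonnegative.
open Classical in
theorem caterpillar_edgeFinset_subset : (caterpillar (2 * n) 0 (n - 1)).edgeFinset ⊆
    univ.image caterpillarPathEdge ∪ univ.image caterpillarPendentEdge := by
  intro e
  induction e with
  | h x y =>
    rw [mem_edgeFinset, mem_edgeSet, mem_union, mem_image, mem_image]
    revert x y
    refine caterpillarVertex_cases (fun i hi => ?_) (fun i hi => ?_) <;>
      refine caterpillarVertex_cases (fun j hj => ?_) (fun j hj => ?_)
    · rw [caterpillar_adj_path_path]
      rintro (rfl | rfl)
      · exact Or.inl ⟨⟨i, by omega⟩, mem_univ _, rfl⟩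
      · exact Or.inl ⟨⟨j, by omega⟩, mem_univ _, Sym2.eq_swap⟩
    · rw [caterpillar_adj_path_pendent]
      rintro rfl
      exact Or.inr ⟨⟨j, hj⟩, mem_univ _, rfl⟩
    · rw [caterpillar_adj_pendent_path]
      rintro rfl
      exact Or.inr ⟨⟨i, hi⟩, mem_univ _, Sym2.eq_swap⟩
    · exact fun h => absurd h caterpillar_adj_pendent_pendent

theorem caterpillar_connected (hn : 0 < n) : (caterpillar (2 * n) 0 (n - 1)).Connected := by
  have hpath : ∀ i hi, (caterpillar (2 * n) 0 (n - 1)).Reachable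
      (caterpillarPath 0 (by omega)) (caterpillarPath i hi) := by
    intro i
    induction i with
    | zero => exact fun _ => Reachable.refl _
    | succ i ih =>
      intro hi
      exact (ih (by omega)).trans (caterpillar_adj_path_path.mpr (Or.inl rfl)).reachable
  rw [connected_iff_exists_forall_reachable]
  refine ⟨caterpillarPath 0 (by omega), caterpillarVertex_cases hpath fun i hi => ?_⟩
  exact (hpath (i + 1) (by omega)).trans (caterpillar_adj_path_pendent.mpr rfl).reachable

theorem caterpillar_isTree (hn : 0 < n) : (caterpillar (2 * n) 0 (n - 1)).IsTree := by
  classical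
  have h1 := (caterpillar_connected hn).card_vert_le_card_edgeSet_add_one
  refine isTree_iff_connected_and_card.mpr ⟨caterpillar_connected hn, le_antisymm ?_ h1⟩
  rw [Nat.card_eq_fintype_card, Nat.card_eq_fintype_card, card_caterpillarVertex hn,
    ← edgeFinset_card]
  have h2 := (card_le_card (caterpillar_edgeFinset_subset (n := n))).trans (card_union_le _ _)
  have h3 := card_image_le (s := univ) (f := caterpillarPathEdge (n := n))
  have h4 := card_image_le (s := univ) (f := caterpillarPendentEdge (n := n))
  rw [card_univ, Fintype.card_fin] at h3 h4
  omega

theorem odd_degree_of_forall_adj_iff {V : Type*} {G : SimpleGraph V} {v : V}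
    [Fintype (G.neighborSet v)] (s : Finset V) (hs : Odd #s) (h : ∀ w, G.Adj v w ↔ w ∈ s) :
    Odd (G.degree v) := by
  have : G.neighborFinset v = s := by
    ext w
    rw [mem_neighborFinset, h]
  rwa [degree, this]

theorem isOddTree_caterpillar (hn : 0 < n) :
    IsOddTree (2 * n) (caterpillar (2 * n) 0 (n - 1)) := by
  classical
  refine ⟨caterpillar_isTree hn, card_caterpillarVertex hn, ?_⟩
  refine caterpillarVertex_cases (fun i hi => ?_) (fun i hi => ?_)
  · by_cases h0 : i = 0
    · refine odd_degree_of_forall_adj_iff {caterpillarPath 1 (by omega)} (by simp)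
        (caterpillarVertex_cases (fun j hj => ?_) (fun j hj => ?_))
      · rw [caterpillar_adj_path_path, mem_singleton, caterpillarPath_inj]
        omega
      · rw [caterpillar_adj_path_pendent, mem_singleton]
        simp only [caterpillarPendent_ne, iff_false]
        omega
    by_cases h1 : i = n
    · refine odd_degree_of_forall_adj_iff {caterpillarPath (n - 1) (by omega)} (by simp)
        (caterpillarVertex_cases (fun j hj => ?_) (fun j hj => ?_))
      · rw [caterpillar_adj_path_path, mem_singleton, caterpillarPath_inj]
        omega
      · rw [caterpillar_adj_path_pendent, mem_singleton]
        simp only [caterpillarPendent_ne, iff_false]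
        omega
    · refine odd_degree_of_forall_adj_iff {caterpillarPath (i - 1) (by omega),
        caterpillarPath (i + 1) (by omega), caterpillarPendent (i - 1) (by omega)} ?_
        (caterpillarVertex_cases (fun j hj => ?_) (fun j hj => ?_))
      · rw [card_eq_three.mpr ⟨_, _, _, ?_, caterpillarPath_ne, caterpillarPath_ne, rfl⟩]
        · decide
        · rw [Ne, caterpillarPath_inj]
          omega
      · rw [caterpillar_adj_path_path, mem_insert, mem_insert, mem_singleton, caterpillarPath_inj,
          caterpillarPath_inj]
        simp only [caterpillarPath_ne, or_false]
        omega
      · rw [caterpillar_adj_path_pendent, mem_insert, mem_insert, mem_singleton,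
          eq_comm (b := caterpillarPath _ _),
          caterpillarPendent_inj]
        simp only [caterpillarPath_ne, caterpillarPendent_ne, false_or]
        omega
  · refine odd_degree_of_forall_adj_iff {caterpillarPath (i + 1) (by omega)} (by simp)
      (caterpillarVertex_cases (fun j hj => ?_) (fun j hj => ?_))
    · rw [caterpillar_adj_pendent_path, mem_singleton, caterpillarPath_inj]
    · rw [mem_singleton]
      simp only [caterpillarPendent_ne, caterpillar_adj_pendent_pendent]

/-- The position along the path of a vertex of `C_{2n,0,n-1}`. -/
def caterpillarRank : CaterpillarVertex (2 * n) 0 (n - 1) → ℕ :=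
  Sum.elim (fun i => i) (Sum.elim (fun i => i) (fun i => i + 1))

theorem ncard_caterpillarRank_le (i : ℕ) (hi : i < n) :
    {x : CaterpillarVertex (2 * n) 0 (n - 1) | caterpillarRank x ≤ i}.ncard = 2 * i + 1 := by
  have hfin : ∀ m k : ℕ, k ≤ m → ∑ j : Fin m, (if (j : ℕ) < k then 1 else 0) = k := by
    intro m k hk
    rw [Fin.sum_univ_eq_sum_range (fun j => if j < k then 1 else 0), ← card_filter]
    have : {j ∈ range m | j < k} = range k := by
      ext j
      rw [mem_filter, mem_range, mem_range]
      omega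
    rw [this, card_range]
  rw [Set.ncard_eq_toFinset_card', Set.toFinset_ofPred, card_filter, Fintype.sum_sum_type,
    Fintype.sum_sum_type]
  simp only [caterpillarRank, Sum.elim_inl, Sum.elim_inr, univ_eq_empty, sum_empty,
    ← Nat.lt_succ_iff]
  simp only [Nat.succ_eq_add_one, Nat.add_lt_add_iff_right]
  rw [hfin _ _ (by omega), hfin _ _ (by omega)]
  omega

theorem edgeImbalance_caterpillarPathEdge (i : Fin n) :
    edgeImbalance (caterpillar (2 * n) 0 (n - 1)) (caterpillarPathEdge i) =
      2 * |2 * ((i : ℕ) : ℤ) - (n - 1 : ℕ)| := by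
  have hn : 0 < n := i.pos
  -- The side up to rank `i` has `i + 1` path and `i` pendent vertices, and `2(2i + 1) - 2n = 2(2i -
  -- (n - 1))`.
  rw [caterpillarPathEdge, edgeImbalance_eq_of_cut (S := {x | caterpillarRank x ≤ i}) ?_
    (caterpillar_connected hn), ncard_caterpillarRank_le _ i.2, card_caterpillarVertex hn]
  · have h2 : (2 : ℤ) = |2| := rfl
    conv_rhs => rw [h2, ← abs_mul]
    rw [← abs_two]
    congr 1
    push_cast [Nat.cast_sub hn]
    ring
  · simp [caterpillarPath, caterpillarRank]
  · simp [caterpillarPath, caterpillarRank]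
  · simp only [Set.mem_ofPred_eq, not_le]
    refine caterpillarVertex_cases (fun a ha => ?_) (fun a ha => ?_) <;>
      refine caterpillarVertex_cases (fun b hb => ?_) (fun b hb => ?_)
    · rw [caterpillar_adj_path_path, caterpillarPath_inj, caterpillarPath_inj]
      simp only [caterpillarPath, caterpillarRank, Sum.elim_inl]
      omega
    · rw [caterpillar_adj_path_pendent]
      simp only [caterpillarPath, caterpillarPendent, caterpillarRank, Sum.elim_inl, Sum.elim_inr]
      omega
    · rw [caterpillar_adj_pendent_path]
      simp only [caterpillarPath, caterpillarPendent, caterpillarRank, Sum.elim_inl, Sum.elim_inr]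
      omega
    · exact fun h => absurd h caterpillar_adj_pendent_pendent

theorem edgeImbalance_caterpillarPendentEdge_le (i : Fin (n - 1)) :
    edgeImbalance (caterpillar (2 * n) 0 (n - 1)) (caterpillarPendentEdge i) ≤ 2 * (n - 1 : ℕ) := by
  have hn : 0 < n := by have := i.pos; omega
  have h := (edgeImbalance_le (caterpillar_adj_path_pendent (n := n) (i := i + 1) (j := i)
    (hi := by omega) (hj := i.2) |>.mpr rfl)).1
  rw [card_caterpillarVertex hn] at h
  refine h.trans (le_of_eq ?_)
  omega

theorem mostarIndex_caterpillar_le (hn : 0 < n) : mostarIndex (caterpillar (2 * n) 0 (n - 1)) ≤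
    (n : ℤ) ^ 2 - (n % 2 : ℕ) + 2 * ((n : ℤ) - 1) ^ 2 := by
  classical
  have himage : ∀ {m : ℕ} (f : Fin m → Sym2 (CaterpillarVertex (2 * n) 0 (n - 1))),
      ∑ e ∈ univ.image f, edgeImbalance (caterpillar (2 * n) 0 (n - 1)) e ≤
        ∑ i, edgeImbalance (caterpillar (2 * n) 0 (n - 1)) (f i) := by
    intro m f
    rw [← sum_fiberwise_of_maps_to (s := univ) (t := univ.image f) (g := f)
      fun i _ => mem_image_of_mem f (mem_univ i)]
    refine sum_le_sum fun e he => ?_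
    obtain ⟨i, -, rfl⟩ := mem_image.mp he
    exact single_le_sum (f := fun j => edgeImbalance (caterpillar (2 * n) 0 (n - 1)) (f j))
      (fun j _ => edgeImbalance_nonneg _) (mem_filter.mpr ⟨mem_univ i, rfl⟩)
  rw [mostarIndex]
  have h1 := sum_le_sum_of_subset_of_nonneg (caterpillar_edgeFinset_subset (n := n))
    fun e _ _ => edgeImbalance_nonneg (G := caterpillar (2 * n) 0 (n - 1)) e
  have h2 := sum_union_inter (s₁ := univ.image (caterpillarPathEdge (n := n)))
    (s₂ := univ.image (caterpillarPendentEdge (n := n)))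
    (f := edgeImbalance (caterpillar (2 * n) 0 (n - 1)))
  have h3 : 0 ≤ ∑ e ∈ univ.image (caterpillarPathEdge (n := n)) ∩
      univ.image (caterpillarPendentEdge (n := n)),
      edgeImbalance (caterpillar (2 * n) 0 (n - 1)) e :=
    sum_nonneg fun e _ => edgeImbalance_nonneg e
  have h4 := himage caterpillarPathEdge
  have h5 := himage caterpillarPendentEdge
  have h6 : ∑ i, edgeImbalance (caterpillar (2 * n) 0 (n - 1)) (caterpillarPendentEdge i) ≤
      2 * ((n : ℤ) - 1) ^ 2 := by
    refine (sum_le_sum fun i _ => edgeImbalance_caterpillarPendentEdge_le i).trans (le_of_eq ?_)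
    rw [sum_const, nsmul_eq_mul, card_univ, Fintype.card_fin]
    push_cast [Nat.cast_sub hn]
    ring
  have h7 : ∑ i, edgeImbalance (caterpillar (2 * n) 0 (n - 1)) (caterpillarPathEdge i) =
      (n : ℤ) ^ 2 - (n % 2 : ℕ) := by
    rw [sum_congr rfl fun i _ => edgeImbalance_caterpillarPathEdge i, ← mul_sum,
      Fin.sum_univ_eq_sum_range (fun i => |2 * (i : ℤ) - (n - 1 : ℕ)|)]
    have := two_mul_sum_abs (n - 1)
    rw [Nat.sub_add_cancel hn] at this
    rw [eq_sub_iff_add_eq, this]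
    push_cast [Nat.cast_sub hn]
    ring
  linarith

/-- The `n + 1` path vertices and `n - 1` pendent vertices are distinct, so they exhaust the `2n`
vertices. -/
theorem IsSpine.nonempty_iso_caterpillar {V : Type*} [Fintype V] {T : SimpleGraph V}
    {p q : ℕ → V} (hs : IsSpine T n p q) (hT : T.IsTree) (hn : 0 < n)
    (hV : Fintype.card V = 2 * n) : Nonempty (T ≃g caterpillar (2 * n) 0 (n - 1)) := by
  have hinj : Function.Injective (caterpillarHom p q hs.adj_succ hs.adj_pendent) := by
    refine caterpillarVertex_cases (fun i hi => ?_) (fun i hi => ?_) <;>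
      refine caterpillarVertex_cases (fun j hj => ?_) (fun j hj => ?_) <;> intro h
    · exact caterpillarPath_inj.mpr (hs.path_inj hT (by omega) (by omega) h)
    · exact absurd h (hs.path_ne_pendent hT (i := i) (j := j + 1) (by omega) (by omega) (by omega))
    · exact absurd h.symm (hs.path_ne_pendent hT (i := j) (j := i + 1) (by omega) (by omega) (by omega))
    · have := hs.pendent_inj hT (i := i + 1) (j := j + 1) (by omega) (by omega) (by omega)
        (by omega) h
      exact caterpillarPendent_inj.mpr (by omega)
  have hbij : Function.Bijective (caterpillarHom p q hs.adj_succ hs.adj_pendent) :=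
    (Fintype.bijective_iff_injective_and_card _).mpr
      ⟨hinj, by rw [hV, card_caterpillarVertex hn]⟩
  exact ((caterpillar_isTree hn).nonempty_iso_of_bijective hT _ hbij).map Iso.symm

/-- The lower bound for the Mostar index of odd trees; it forces a spine of full length. -/
theorem IsOddTree.mostarIndex_ge {V : Type*} [Fintype V] {T : SimpleGraph V} (hn : 0 < n)
    (hT : IsOddTree (2 * n) T) :
    (n : ℤ) ^ 2 - (n % 2 : ℕ) + 2 * ((n : ℤ) - 1) ^ 2 ≤ mostarIndex T ∧
    (mostarIndex T ≤ (n : ℤ) ^ 2 - (n % 2 : ℕ) + 2 * ((n : ℤ) - 1) ^ 2 →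
      Nonempty (T ≃g caterpillar (2 * n) 0 (n - 1))) := by
  classical
  obtain ⟨htree, hcard, hodd⟩ := hT
  obtain ⟨d, p, q, hs⟩ := htree.exists_isSpine hodd
  have hd : 0 < d := by
    by_contra h0
    have : Fintype.card V ≤ 1 := Fintype.card_le_one_iff.mpr fun a b => by
      have := hs.dist_le a b
      exact htree.connected.dist_eq_zero_iff.mp (by omega)
    omega
  have hdn := hs.two_mul_le_card htree
  have h := hs.mostarIndex_ge htree hd
  rw [hcard] at hdn h
  push_cast only [Nat.cast_mul, Nat.cast_ofNat] at h
  rcases Nat.lt_or_ge d n with hlt | hge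
  -- With `n = d + k + 1`, the bound at `d` exceeds the one at `n` by `(k + 1)(k + 3) ≥ 3` apart
  -- from parity terms, which change it by at most one.
  · obtain ⟨k, rfl⟩ := Nat.exists_eq_add_of_lt hlt
    have : ((d + k + 1 : ℕ) : ℤ) ^ 2 - ((d + k + 1) % 2 : ℕ) +
        2 * (((d + k + 1 : ℕ) : ℤ) - 1) ^ 2 < mostarIndex T := by
      push_cast only [Nat.cast_add, Nat.cast_one] at h ⊢
      have h1 : (0 : ℤ) ≤ ((d + 1) % 2 : ℕ) := Nat.cast_nonneg _
      have h2 : (0 : ℤ) ≤ k := Nat.cast_nonneg _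
      have h3 : (0 : ℤ) ≤ ((d + k + 1) % 2 : ℕ) := Nat.cast_nonneg _
      nlinarith [sq_nonneg (k : ℤ)]
    exact ⟨this.le, fun h' => absurd this h'.not_gt⟩
  · obtain rfl : d = n := by omega
    refine ⟨?_, fun _ => hs.nonempty_iso_caterpillar htree hd hcard⟩
    have h1 : (((d + 1) % 2 : ℕ) : ℤ) = 1 - (d % 2 : ℕ) := by omega
    rw [h1] at h
    linarith

end Caterpillar

theorem mainTheorem8 (n : ℕ) (hn : 0 < n) :
    IsOddTree (2 * n) (starTree (2 * n) (Nat.mul_pos Nat.two_pos hn)) ∧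
    IsOddTree (2 * n) (caterpillar (2 * n) 0 (n - 1)) ∧
    ∀ (V : Type*) [Fintype V] (T : SimpleGraph V), IsOddTree (2 * n) T →
      (mostarIndex T ≤ mostarIndex (starTree (2 * n) (Nat.mul_pos Nat.two_pos hn)) ∧
        (mostarIndex T = mostarIndex (starTree (2 * n) (Nat.mul_pos Nat.two_pos hn)) ↔
          Nonempty (T ≃g starTree (2 * n) (Nat.mul_pos Nat.two_pos hn)))) ∧
      (mostarIndex (caterpillar (2 * n) 0 (n - 1)) ≤ mostarIndex T ∧
        (mostarIndex T = mostarIndex (caterpillar (2 * n) 0 (n - 1)) ↔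
          Nonempty (T ≃g caterpillar (2 * n) 0 (n - 1)))) := by
  have hV : 2 ≤ Fintype.card (Fin (2 * n)) := by
    rw [Fintype.card_fin]
    omega
  refine ⟨isOddTree_starTree n _, isOddTree_caterpillar hn, fun V _ T hT => ⟨?_, ?_⟩⟩
  · have hcard : Fintype.card V = Fintype.card (Fin (2 * n)) := by rw [hT.2.1, Fintype.card_fin]
    have hS : mostarIndex (starTree (2 * n) (Nat.mul_pos Nat.two_pos hn)) =
        ((Fintype.card V : ℤ) - 1) * (Fintype.card V - 2) := by
      rw [hcard]
      exact mostarIndex_starGraph _ hV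
    refine ⟨hS ▸ hT.1.mostarIndex_le.1, fun h => ?_, fun ⟨f⟩ => mostarIndex_iso hT.1.connected f⟩
    obtain ⟨c, rfl⟩ := (hT.1.mostarIndex_eq_iff (hcard ▸ hV)).mp (h.trans hS)
    exact nonempty_iso_starGraph hcard c _
  -- Only an upper estimate for the caterpillar is needed: a tree attaining its index meets the
  -- threshold that forces the isomorphism.
  · have hC := mostarIndex_caterpillar_le hn
    obtain ⟨h1, h2⟩ := hT.mostarIndex_ge hn
    exact ⟨hC.trans h1, fun h => h2 (h.le.trans hC), fun ⟨f⟩ => mostarIndex_iso hT.1.connected f⟩
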